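/- Let $\mathcal X$ be a real Banach space and let $\mathcal A\subset\mathcal X\times\mathcal X$ be a (possibly nonlinear and multivalued) m-accretive operator with dense domain, i.e. $\|(x-\hat x)+\lambda(y-\hat y)\|\ge\|x-\hat x\|$ for all $(x,y),(\hat x,\hat y)\in\mathcal A$ and $\lambda\ge 0$, the range of $I+\mathcal A$ is $\mathcal X$, and $\overline{D(\mathcal A)}=\mathcal X$. Let $S(t)x=\lim_{n\to\infty}(I+\tfrac tn\mathcal A)^{-n}x$, $t\ge 0$, be the contraction semigroup generated by $\mathcal A$. Let $0<T<\infty$, $u_0\in\mathcal X$, and let $F:[0,T]\times\mathcal X\to\mathcal X$ be such that $F(\cdot,x)$ is Bochner integrable on $(0,T)$ for every $x\in\mathcal X$ and $$\|F(t,u)-F(t,v)\|\le K(t,\|u-v\|)\quad\text{for a.e. } t\in(0,T)\text{ and all }u,v\in\mathcal X,$$ where $K:[0,T]\times[0,\infty)\to[0,\infty)$ satisfies: $K(\cdot,U)$ is locally integrable on $[0,T]$ for each $U\ge 0$, $K(t,\cdot)$ is continuous and nondecreasing for a.e. $t\in(0,T)$, and $K(t,0)=0$ for all $t\in[0,T]$.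 Suppose that there are $p\in(1,\infty]$ and $\phi\in L^p(0,T)$ such that $$K(t,U)\le\phi(t)\,U\quad\text{for a.e. }t\in(0,T)\text{ and all }U\ge 0.$$ Then the operator $$\mathcal G^{u_0}u(t)=S(t)u_0+\int_0^tS(t-s)F(s,u(s))\,ds,\qquad 0\le t\le T,$$ is well defined from $C([0,T];\mathcal X)$ to $C([0,T];\mathcal X)$ (the integral being a Bochner integral), and it is a strict contraction for the norm $\sup_{0\le t\le T}e^{-\gamma t}\|u(t)\|$, i.e. it is Lipschitz for this norm with some constant $k<1$, whenever $$\gamma>\frac{p-1}{p}\,\|\phi\|_{L^p(0,T)}^{\frac p{p-1}}\ \text{ if }1<p<\infty,\qquad \gamma>\|\phi\|_{L^\infty(0,T)}\ \text{ if }p=\infty.$$ Consequently, in both cases, $\mathcal G^{u_0}$ has a unique fixed point in $C([0,T];\mathcal X)$. -/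

import Mathlib

open MeasureTheory Set Filter Topology
open scoped ENNReal

noncomputable section

namespace NonlinearCauchy

variable {X : Type*} [NormedAddCommGroup X] [NormedSpace ℝ X]

/-- A (possibly nonlinear and multivalued) operator on `X`, given by its graph `A ⊆ X × X`, is
m-accretive: `‖(x - x') + l (y - y')‖ ≥ ‖x - x'‖` for all `(x, y), (x', y') ∈ A` and `l ≥ 0`,
and the range of `I + A` is all of `X`. -/
structure IsMAccretive (A : Set (X × X)) : Prop where
  accretive : ∀ p ∈ A, ∀ q ∈ A, ∀ l : ℝ, 0 ≤ l →
    ‖p.1 - q.1‖ ≤ ‖(p.1 - q.1) + l • (p.2 - q.2)‖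
  range_eq : ∀ z : X, ∃ p ∈ A, p.1 + p.2 = z

/-- The domain `D(A) = {x | ∃ y, (x, y) ∈ A}`. -/
def domain (A : Set (X × X)) : Set X := {x | ∃ y, (x, y) ∈ A}

open Classical in
/-- The resolvent `J_l = (I + l A)⁻¹`: `resolventMap A l z` is the point `x` such that
`z ∈ x + l A x`. For m-accretive `A` and `l > 0` this `x` exists for all `z` and is unique.
Outside the range of `I + l A` (for m-accretive `A` only possible at `l = 0`) the value is `z`,
so that `J_0` is the identity. -/
def resolventMap (A : Set (X × X)) (l : ℝ) (z : X) : X :=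
  if h : ∃ x y, (x, y) ∈ A ∧ x + l • y = z then h.choose else z

/-- The nonlinear semigroup generated by `A`, by the exponential formula
`S(t) x = lim_{n → ∞} (I + (t / n) A)⁻ⁿ x`. For m-accretive `A` with dense domain in a Banach
space the limit exists for all `t ≥ 0` and all `x`. -/
def semigroup (A : Set (X × X)) (t : ℝ) (x : X) : X :=
  limUnder atTop (fun n : ℕ => (resolventMap A (t / n))^[n] x)

/-- The structural condition on the perturbation `F` with modulus `K`, on the interval `[0, T]`. -/
structure StructuralCondition (T : ℝ) (K : ℝ → ℝ → ℝ) (F : ℝ → X → X) : Prop where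
  nonneg : ∀ t ∈ Icc 0 T, ∀ U, 0 ≤ U → 0 ≤ K t U
  locallyIntegrable : ∀ U, 0 ≤ U → LocallyIntegrableOn (fun t => K t U) (Icc 0 T) volume
  continuous : ∀ᵐ t ∂(volume.restrict (Ioo 0 T)), ContinuousOn (K t) (Ici 0)
  monotone : ∀ᵐ t ∂(volume.restrict (Ioo 0 T)), MonotoneOn (K t) (Ici 0)
  map_zero : ∀ t ∈ Icc 0 T, K t 0 = 0
  bound : ∀ᵐ t ∂(volume.restrict (Ioo 0 T)), ∀ u v : X, ‖F t u - F t v‖ ≤ K t ‖u - v‖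

/-- The integrand `s ↦ S(t - s) F(s, u(s))`, for `u ∈ C([0, T]; X)`
(only its values for `0 ≤ s ≤ t ≤ T` matter). -/
def duhamelIntegrand (A : Set (X × X)) (F : ℝ → X → X) {T : ℝ} (hT : 0 ≤ T)
    (u : C(Icc (0 : ℝ) T, X)) (t s : ℝ) : X :=
  semigroup A (t - s) (F s (IccExtend hT u s))

/-- The function `t ↦ S(t) u₀ + ∫₀ᵗ S(t - s) F(s, u(s)) ds`. -/
def duhamelMap (A : Set (X × X)) (F : ℝ → X → X) {T : ℝ} (hT : 0 ≤ T) (u₀ : X)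
    (u : C(Icc (0 : ℝ) T, X)) (t : ℝ) : X :=
  semigroup A t u₀ + ∫ s in (0 : ℝ)..t, duhamelIntegrand A F hT u t s

/-- The Bielecki norm `sup_{0 ≤ t ≤ T} e^{-γ t} ‖u(t)‖` on `C([0, T]; X)`. -/
def bieleckiNorm {T : ℝ} (γ : ℝ) (u : C(Icc (0 : ℝ) T, X)) : ℝ :=
  ⨆ t : Icc (0 : ℝ) T, Real.exp (-γ * (t : ℝ)) * ‖u t‖

/-- `G` is a strict contraction of `C([0, T]; X)` for the Bielecki norm with weight `γ`. -/
def IsBieleckiContraction {T : ℝ} (γ : ℝ)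
    (G : C(Icc (0 : ℝ) T, X) → C(Icc (0 : ℝ) T, X)) : Prop :=
  ∃ k : ℝ, 0 ≤ k ∧ k < 1 ∧
    ∀ u v, bieleckiNorm γ (G u - G v) ≤ k * bieleckiNorm γ (u - v)

/-- The norm of `φ` in `L^p(0, T)` (finite, and so not a junk value, when `φ ∈ L^p(0, T)`). -/
def lpNormOn (T : ℝ) (p : ℝ≥0∞) (φ : ℝ → ℝ) : ℝ :=
  (eLpNorm φ p (volume.restrict (Ioo 0 T))).toReal

end NonlinearCauchy

end

/-!
Accretivity makes the resolvents `J_l` nonexpansive, and it gives Kobayashi's estimate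
`‖J_l^i x - J_m^j x‖ ≤ √((i l - j m)² + i l² + j m²) ‖y‖` for `(x, y) ∈ A`. Hence the Euler iterates
defining `S(t) x` converge, and `S` consists of nonexpansive maps and is strongly continuous.
The fixed point map `G` then satisfies `‖G u(t) - G v(t)‖ ≤ ∫₀ᵗ |φ(s)| ‖u(s) - v(s)‖ ds`; bounding
`‖u(s) - v(s)‖` by `e^{γ s}` times the Bielecki norm of `u - v` and applying Hölder's inequality to
`|φ(s)| e^{γ s}`, with `q` conjugate to `p`, gives the contraction constant
`‖φ‖_p (γ q)^{-1/q}`, which is less than `1` exactly when `γ > ‖φ‖_p^q / q`.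
-/

namespace NonlinearCauchy

section Resolvent

variable {X : Type*} [NormedAddCommGroup X] [NormedSpace ℝ X] {A : Set (X × X)}

/-- Accretivity of the operator with graph `A`: the resolvents are nonexpansive on their domains. -/
def IsAccretive (A : Set (X × X)) : Prop :=
  ∀ p ∈ A, ∀ q ∈ A, ∀ l : ℝ, 0 ≤ l → ‖p.1 - q.1‖ ≤ ‖(p.1 - q.1) + l • (p.2 - q.2)‖

/-- The range condition at step length `l`: the range of `I + l A` is the whole space. -/
def RangeCondition (A : Set (X × X)) (l : ℝ) : Prop :=
  ∀ z : X, ∃ x y, (x, y) ∈ A ∧ x + l • y = z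

theorem IsMAccretive.isAccretive (hA : IsMAccretive A) : IsAccretive A :=
  hA.accretive

theorem IsMAccretive.rangeCondition_one (hA : IsMAccretive A) : RangeCondition A 1 := by
  intro z
  obtain ⟨⟨x, y⟩, hxy, hz⟩ := hA.range_eq z
  exact ⟨x, y, hxy, by rwa [one_smul]⟩

theorem IsAccretive.norm_sub_le (hA : IsAccretive A) {x y x' y' : X} (h : (x, y) ∈ A)
    (h' : (x', y') ∈ A) {l : ℝ} (hl : 0 ≤ l) :
    ‖x - x'‖ ≤ ‖(x + l • y) - (x' + l • y')‖ := by
  rw [add_sub_add_comm, ← smul_sub]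
  exact hA _ h _ h' l hl

theorem IsAccretive.rangeCondition_of_lt [CompleteSpace X] (hA : IsAccretive A) {l₀ l : ℝ}
    (hl₀ : 0 < l₀) (hl : l₀ < 2 * l) (h : RangeCondition A l₀) : RangeCondition A l := by
  intro z
  choose J Y hJA hJ using h
  have hlpos : 0 < l := by linarith
  -- With `c = l₀ / l`, the equation `z ∈ x + l A x` says that `x` is a fixed point of
  -- `x ↦ J (c z + (1 - c) x)`, where `J` is the resolvent of step `l₀`.
  set c : ℝ := l₀ / l with hc
  have hc_lt : ‖1 - c‖₊ < 1 := by
    rw [← NNReal.coe_lt_coe, coe_nnnorm, Real.norm_eq_abs, NNReal.coe_one, abs_lt]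
    constructor <;> linarith [(div_lt_iff₀ hlpos).2 hl, div_pos hl₀ hlpos]
  have hJ_lip : LipschitzWith 1 J := LipschitzWith.of_dist_le_mul fun w w' => by
    simpa [dist_eq_norm, hJ] using hA.norm_sub_le (hJA w) (hJA w') hl₀.le
  have hmap_lip : LipschitzWith ‖1 - c‖₊ fun x => c • z + (1 - c) • x :=
    LipschitzWith.of_dist_le_mul fun x x' => by rw [dist_add_left, dist_smul₀, coe_nnnorm]
  have hcontr : ContractingWith ‖1 - c‖₊ fun x => J (c • z + (1 - c) • x) :=
    ⟨hc_lt, by simpa [Function.comp_def] using hJ_lip.comp hmap_lip⟩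
  obtain ⟨x, hx⟩ : ∃ x, J (c • z + (1 - c) • x) = x := ⟨_, hcontr.fixedPoint_isFixedPt⟩
  have hmem := hJA (c • z + (1 - c) • x)
  have hsum := hJ (c • z + (1 - c) • x)
  rw [hx] at hmem hsum
  refine ⟨x, _, hmem, ?_⟩
  generalize Y (c • z + (1 - c) • x) = y at hsum
  calc x + l • y = c⁻¹ • ((x + l₀ • y) - (1 - c) • x) := by
        rw [hc]; match_scalars <;> field_simp; ring
    _ = z := by rw [hsum, add_sub_cancel_right, inv_smul_smul₀ (div_pos hl₀ hlpos).ne']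

theorem IsMAccretive.rangeCondition [CompleteSpace X] (hA : IsMAccretive A) {l : ℝ}
    (hl : 0 < l) : RangeCondition A l := by
  have key (n : ℕ) : ∀ l : ℝ, (1 / 2 : ℝ) ^ n < l → RangeCondition A l := by
    induction n with
    | zero =>
      intro l hl
      rw [pow_zero] at hl
      exact hA.isAccretive.rangeCondition_of_lt one_pos (by linarith) hA.rangeCondition_one
    | succ n ih =>
      intro l hl
      have hpos : (0 : ℝ) < (1 / 2) ^ n := by positivity
      rw [pow_succ] at hl
      exact hA.isAccretive.rangeCondition_of_lt (l₀ := l + (1 / 2) ^ n * (1 / 2)) (by linarith)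
        (by linarith) (ih _ (by linarith))
  obtain ⟨n, hn⟩ := exists_pow_lt_of_lt_one hl (by norm_num : (1 / 2 : ℝ) < 1)
  exact key n l hn

theorem RangeCondition.resolventMap_spec {l : ℝ} (h : RangeCondition A l) (z : X) :
    ∃ y, (resolventMap A l z, y) ∈ A ∧ resolventMap A l z + l • y = z := by
  rw [resolventMap, dif_pos (h z)]
  exact (h z).choose_spec

theorem resolventMap_zero (A : Set (X × X)) : resolventMap A 0 = id := by
  ext z
  unfold resolventMap
  split_ifs with h
  · obtain ⟨y, -, hy⟩ := h.choose_spec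
    simpa using hy
  · rfl

variable [CompleteSpace X]

theorem IsMAccretive.lipschitzWith_resolventMap (hA : IsMAccretive A) {l : ℝ}
    (hl : 0 ≤ l) : LipschitzWith 1 (resolventMap A l) := by
  rcases hl.eq_or_lt with rfl | hl
  · rw [resolventMap_zero]
    exact LipschitzWith.id
  · refine LipschitzWith.of_dist_le_mul fun z z' => ?_
    obtain ⟨y, h, hy⟩ := (hA.rangeCondition hl).resolventMap_spec z
    obtain ⟨y', h', hy'⟩ := (hA.rangeCondition hl).resolventMap_spec z'
    simpa [dist_eq_norm, hy, hy'] using hA.isAccretive.norm_sub_le h h' hl.le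

theorem IsMAccretive.lipschitzWith_iterate_resolventMap (hA : IsMAccretive A)
    {l : ℝ} (hl : 0 ≤ l) (n : ℕ) : LipschitzWith 1 (resolventMap A l)^[n] := by
  simpa using (hA.lipschitzWith_resolventMap hl).iterate n

theorem IsMAccretive.dist_resolventMap_self_le (hA : IsMAccretive A) {l : ℝ} (hl : 0 ≤ l)
    {x y : X} (hxy : (x, y) ∈ A) : dist (resolventMap A l x) x ≤ l * ‖y‖ := by
  rcases hl.eq_or_lt with rfl | hl
  · simp [resolventMap_zero]
  · obtain ⟨w, h, hw⟩ := (hA.rangeCondition hl).resolventMap_spec x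
    simpa [dist_eq_norm, hw, norm_smul, abs_of_pos hl] using
      hA.isAccretive.norm_sub_le h hxy hl.le

theorem IsMAccretive.dist_iterate_resolventMap_self_le (hA : IsMAccretive A)
    {l : ℝ} (hl : 0 ≤ l) {x y : X} (hxy : (x, y) ∈ A) (n : ℕ) :
    dist ((resolventMap A l)^[n] x) x ≤ n * l * ‖y‖ := by
  have hstep (k : ℕ) :
      dist ((resolventMap A l)^[k] x) ((resolventMap A l)^[k + 1] x) ≤ l * ‖y‖ := by
    rw [Function.iterate_succ_apply, dist_comm]
    refine ((hA.lipschitzWith_iterate_resolventMap hl k).dist_le_mul _ _).trans ?_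
    simpa using hA.dist_resolventMap_self_le hl hxy
  have hsum := dist_le_range_sum_of_dist_le (f := fun k => (resolventMap A l)^[k] x) n
    fun {k} _ => hstep k
  simpa [dist_comm, mul_assoc] using hsum

theorem IsMAccretive.dist_resolventMap_resolventMap_le (hA : IsMAccretive A) {l m : ℝ}
    (hl : 0 ≤ l) (hm : 0 ≤ m) (hlm : 0 < l + m) (x x' : X) :
    dist (resolventMap A l x) (resolventMap A m x') ≤
      m / (l + m) * dist x (resolventMap A m x') +
        l / (l + m) * dist (resolventMap A l x) x' := by
  rcases hl.eq_or_lt with rfl | hl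
  · rw [zero_add] at hlm
    simp [resolventMap_zero, hlm.ne']
  rcases hm.eq_or_lt with rfl | hm
  · simp [resolventMap_zero, hl.ne']
  obtain ⟨y, h, hy⟩ := (hA.rangeCondition hl).resolventMap_spec x
  obtain ⟨y', h', hy'⟩ := (hA.rangeCondition hm).resolventMap_spec x'
  set z' := resolventMap A m x'
  set z := resolventMap A l x
  -- Accretivity is tested with the harmonic step `l m / (l + m)`.
  have hcomb : (z + (l * m / (l + m)) • y) - (z' + (l * m / (l + m)) • y') =
      (m / (l + m)) • (x - z') + (l / (l + m)) • (z - x') := by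
    rw [← hy, ← hy']
    match_scalars <;> field_simp <;> ring
  calc dist z z' = ‖z - z'‖ := dist_eq_norm _ _
    _ ≤ ‖(m / (l + m)) • (x - z') + (l / (l + m)) • (z - x')‖ :=
        hcomb ▸ hA.isAccretive.norm_sub_le h h' (by positivity)
    _ ≤ ‖(m / (l + m)) • (x - z')‖ + ‖(l / (l + m)) • (z - x')‖ := norm_add_le _ _
    _ = m / (l + m) * dist x z' + l / (l + m) * dist z x' := by
        rw [norm_smul, norm_smul, Real.norm_of_nonneg (by positivity),
          Real.norm_of_nonneg (by positivity), dist_eq_norm, dist_eq_norm]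

end Resolvent

section Kobayashi

/-- The factor in Kobayashi's estimate of the distance between `i` implicit Euler steps of length
`l` and `j` implicit Euler steps of length `m`. -/
noncomputable def kobayashiBound (l m : ℝ) (i j : ℕ) : ℝ :=
  √((i * l - j * m) ^ 2 + i * l ^ 2 + j * m ^ 2)

theorem abs_sub_le_kobayashiBound (l m : ℝ) (i j : ℕ) :
    |i * l - j * m| ≤ kobayashiBound l m i j :=
  Real.abs_le_sqrt (by rw [add_assoc]; exact le_add_of_nonneg_right (by positivity))

theorem kobayashiBound_convexComb_le {l m : ℝ} (hl : 0 ≤ l) (hm : 0 ≤ m) (hlm : 0 < l + m)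
    (i j : ℕ) :
    m / (l + m) * kobayashiBound l m i (j + 1) + l / (l + m) * kobayashiBound l m (i + 1) j ≤
      kobayashiBound l m (i + 1) (j + 1) := by
  have hconcave := Real.strictConcaveOn_sqrt.concaveOn.2
    (x := ((i : ℝ) * l - (j + 1 : ℕ) * m) ^ 2 + i * l ^ 2 + (j + 1 : ℕ) * m ^ 2)
    (y := ((i + 1 : ℕ) * l - (j : ℝ) * m) ^ 2 + (i + 1 : ℕ) * l ^ 2 + (j : ℝ) * m ^ 2)
    (by rw [mem_Ici]; positivity) (by rw [mem_Ici]; positivity)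
    (by positivity : 0 ≤ m / (l + m)) (by positivity : 0 ≤ l / (l + m)) (by field_simp; ring)
  refine hconcave.trans_eq (congrArg Real.sqrt ?_)
  simp only [smul_eq_mul]
  push_cast
  field_simp
  ring

theorem le_kobayashiBound_mul {a : ℕ → ℕ → ℝ} {l m M : ℝ} (hl : 0 ≤ l) (hm : 0 ≤ m)
    (hlm : 0 < l + m) (hM : 0 ≤ M) (hi : ∀ i, a i 0 ≤ i * l * M) (hj : ∀ j, a 0 j ≤ j * m * M)
    (h : ∀ i j, a (i + 1) (j + 1) ≤ m / (l + m) * a i (j + 1) + l / (l + m) * a (i + 1) j)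
    (i j : ℕ) : a i j ≤ kobayashiBound l m i j * M := by
  induction i generalizing j with
  | zero =>
    refine (hj j).trans (mul_le_mul_of_nonneg_right ?_ hM)
    simpa [abs_of_nonneg hm] using abs_sub_le_kobayashiBound l m 0 j
  | succ i ihi =>
    induction j with
    | zero =>
      refine (hi (i + 1)).trans (mul_le_mul_of_nonneg_right ?_ hM)
      simpa using (le_abs_self _).trans (abs_sub_le_kobayashiBound l m (i + 1) 0)
    | succ j ihj =>
      calc a (i + 1) (j + 1)
          ≤ m / (l + m) * a i (j + 1) + l / (l + m) * a (i + 1) j := h i j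
        _ ≤ m / (l + m) * (kobayashiBound l m i (j + 1) * M) +
              l / (l + m) * (kobayashiBound l m (i + 1) j * M) := by
            gcongr
            exact ihi (j + 1)
        _ = (m / (l + m) * kobayashiBound l m i (j + 1) +
              l / (l + m) * kobayashiBound l m (i + 1) j) * M := by ring
        _ ≤ kobayashiBound l m (i + 1) (j + 1) * M :=
            mul_le_mul_of_nonneg_right (kobayashiBound_convexComb_le hl hm hlm i j) hM

end Kobayashi

theorem cauchySeq_of_dense_of_equicontinuousAt {α β : Type*} [PseudoMetricSpace α]
    [PseudoMetricSpace β] {f : ℕ → α → β} {s : Set α} (hs : Dense s)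
    (hf : ∀ x ∈ s, CauchySeq fun n => f n x) {x : α} (hx : EquicontinuousAt f x) :
    CauchySeq fun n => f n x := by
  rw [Metric.cauchySeq_iff]
  intro ε hε
  obtain ⟨δ, hδ, hnear⟩ := Metric.equicontinuousAt_iff.1 hx (ε / 3) (by positivity)
  obtain ⟨x', hx's, hx'⟩ := hs.exists_dist_lt x hδ
  obtain ⟨N, hN⟩ := Metric.cauchySeq_iff.1 (hf x' hx's) (ε / 3) (by positivity)
  refine ⟨N, fun m hm n hn => ?_⟩
  have hclose (k : ℕ) : dist (f k x) (f k x') < ε / 3 := hnear x' (dist_comm x x' ▸ hx') k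
  linarith [dist_triangle4 (f m x) (f m x') (f n x') (f n x), hN m hm n hn, hclose m, hclose n,
    dist_comm (f n x) (f n x')]

section Semigroup

variable {X : Type*} [NormedAddCommGroup X] [NormedSpace ℝ X] [CompleteSpace X]
  {A : Set (X × X)}

theorem IsMAccretive.dist_iterate_resolventMap_le (hA : IsMAccretive A) {l m : ℝ} (hl : 0 ≤ l)
    (hm : 0 ≤ m) {x y : X} (hxy : (x, y) ∈ A) (i j : ℕ) :
    dist ((resolventMap A l)^[i] x) ((resolventMap A m)^[j] x) ≤
      kobayashiBound l m i j * ‖y‖ := by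
  rcases (add_nonneg hl hm).eq_or_lt' with hlm | hlm
  · obtain ⟨rfl, rfl⟩ := (add_eq_zero_iff_of_nonneg hl hm).1 hlm
    simp [resolventMap_zero, kobayashiBound]
  refine le_kobayashiBound_mul (M := ‖y‖)
    (a := fun i j => dist ((resolventMap A l)^[i] x) ((resolventMap A m)^[j] x))
    hl hm hlm (norm_nonneg y) (hA.dist_iterate_resolventMap_self_le hl hxy) (fun j => ?_)
    (fun i j => ?_) i j
  · exact (dist_comm _ _).trans_le (hA.dist_iterate_resolventMap_self_le hm hxy j)
  · simp only [Function.iterate_succ_apply']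
    exact hA.dist_resolventMap_resolventMap_le hl hm hlm _ _

theorem IsMAccretive.dist_euler_le (hA : IsMAccretive A) {t s : ℝ} (ht : 0 ≤ t) (hs : 0 ≤ s)
    {x y : X} (hxy : (x, y) ∈ A) {i j : ℕ} (hi : i ≠ 0) (hj : j ≠ 0) :
    dist ((resolventMap A (t / i))^[i] x) ((resolventMap A (s / j))^[j] x) ≤
      √((t - s) ^ 2 + t ^ 2 / i + s ^ 2 / j) * ‖y‖ := by
  refine (hA.dist_iterate_resolventMap_le (by positivity) (by positivity) hxy i j).trans_eq ?_
  rw [kobayashiBound]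
  congr 2
  field_simp

theorem tendsto_euler_bound {ι : Type*} {f : Filter ι} {i j : ι → ℕ} (hi : Tendsto i f atTop)
    (hj : Tendsto j f atTop) (t s M : ℝ) :
    Tendsto (fun n => √((t - s) ^ 2 + t ^ 2 / i n + s ^ 2 / j n) * M) f (𝓝 (|t - s| * M)) := by
  have hdiv (r : ℝ) : Tendsto (fun n : ℕ => r ^ 2 / (n : ℝ)) atTop (𝓝 0) :=
    tendsto_const_div_atTop_nhds_zero_nat _
  simpa [← Real.sqrt_sq_eq_abs] using (((tendsto_const_nhds (x := (t - s) ^ 2)).add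
    ((hdiv t).comp hi)).add ((hdiv s).comp hj)).sqrt.mul_const M

theorem IsMAccretive.cauchySeq_euler_of_mem (hA : IsMAccretive A) {t : ℝ} (ht : 0 ≤ t)
    {x y : X} (hxy : (x, y) ∈ A) :
    CauchySeq (fun n : ℕ => (resolventMap A (t / n))^[n] x) := by
  rw [cauchySeq_iff_tendsto_dist_atTop_0, ← prod_atTop_atTop_eq]
  have hbound := tendsto_euler_bound (f := atTop ×ˢ atTop) tendsto_fst tendsto_snd t t ‖y‖
  rw [sub_self, abs_zero, zero_mul] at hbound
  refine squeeze_zero' (Eventually.of_forall fun _ => dist_nonneg) ?_ hbound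
  filter_upwards [(eventually_ne_atTop 0).prod_mk (eventually_ne_atTop 0)] with n hn
  simpa using hA.dist_euler_le ht ht hxy hn.1 hn.2

theorem IsMAccretive.cauchySeq_euler (hA : IsMAccretive A) (hdense : Dense (domain A)) {t : ℝ}
    (ht : 0 ≤ t) (x : X) : CauchySeq (fun n : ℕ => (resolventMap A (t / n))^[n] x) :=
  cauchySeq_of_dense_of_equicontinuousAt (f := fun n : ℕ => (resolventMap A (t / n))^[n]) hdense
    (fun _ ⟨_, hxy⟩ => hA.cauchySeq_euler_of_mem ht hxy)
    ((LipschitzWith.uniformEquicontinuous _ 1 fun n =>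
      hA.lipschitzWith_iterate_resolventMap (by positivity) n).equicontinuous x)

theorem IsMAccretive.tendsto_semigroup (hA : IsMAccretive A) (hdense : Dense (domain A)) {t : ℝ}
    (ht : 0 ≤ t) (x : X) :
    Tendsto (fun n : ℕ => (resolventMap A (t / n))^[n] x) atTop (𝓝 (semigroup A t x)) :=
  (hA.cauchySeq_euler hdense ht x).tendsto_limUnder

theorem IsMAccretive.lipschitzWith_semigroup (hA : IsMAccretive A) (hdense : Dense (domain A))
    {t : ℝ} (ht : 0 ≤ t) : LipschitzWith 1 (semigroup A t) :=
  LipschitzWith.of_dist_le_mul fun x x' => le_of_tendsto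
    ((hA.tendsto_semigroup hdense ht x).dist (hA.tendsto_semigroup hdense ht x'))
    (Eventually.of_forall fun n =>
      (hA.lipschitzWith_iterate_resolventMap (by positivity) n).dist_le_mul x x')

theorem IsMAccretive.lipschitzOnWith_semigroup_apply (hA : IsMAccretive A)
    (hdense : Dense (domain A)) {x y : X} (hxy : (x, y) ∈ A) :
    LipschitzOnWith ‖y‖₊ (fun t => semigroup A t x) (Ici 0) := by
  refine LipschitzOnWith.of_dist_le_mul fun t ht s hs => ?_
  rw [Real.dist_eq, mul_comm]
  refine le_of_tendsto_of_tendsto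
    ((hA.tendsto_semigroup hdense ht x).dist (hA.tendsto_semigroup hdense hs x))
    (tendsto_euler_bound tendsto_id tendsto_id t s ‖y‖) ?_
  filter_upwards [eventually_ne_atTop 0] with n hn
  exact hA.dist_euler_le ht hs hxy hn hn

end Semigroup

section ContractionFamily

variable {X : Type*} [NormedAddCommGroup X] {S : ℝ → X → X}

/-- A strongly continuous family of nonexpansive maps indexed by `[0, ∞)`. This is the part of the
notion of a contraction semigroup that the Duhamel formula uses; the semigroup law is left out. -/
structure IsContractionFamily (S : ℝ → X → X) : Prop where
  lipschitzWith : ∀ t, 0 ≤ t → LipschitzWith 1 (S t)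
  continuousOn : ∀ x, ContinuousOn (fun t => S t x) (Ici 0)

theorem IsMAccretive.isContractionFamily_semigroup [NormedSpace ℝ X] [CompleteSpace X]
    {A : Set (X × X)} (hA : IsMAccretive A) (hdense : Dense (domain A)) :
    IsContractionFamily (semigroup A) where
  lipschitzWith _ ht := hA.lipschitzWith_semigroup hdense ht
  continuousOn x := by
    have hjoint : ContinuousOn (fun q : ℝ × X => semigroup A q.1 q.2) (Ici 0 ×ˢ univ) :=
      continuousOn_prod_of_subset_closure_continuousOn_lipschitzOnWith'
        (fun q : ℝ × X => semigroup A q.1 q.2) (subset_univ _) hdense.closure_eq.ge 1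
        (fun _ ht => (hA.lipschitzWith_semigroup hdense ht).lipschitzOnWith)
        fun _ ⟨_, hxy⟩ => (hA.lipschitzOnWith_semigroup_apply hdense hxy).continuousOn
    exact hjoint.comp (f := fun t : ℝ => (t, x)) (by fun_prop) fun _ ht => ⟨ht, mem_univ x⟩

-- The reflected family `t ↦ S |t|` extends `S` continuously to negative times.
theorem IsContractionFamily.continuous_uncurry_abs (hS : IsContractionFamily S) :
    Continuous fun q : ℝ × X => S |q.1| q.2 :=
  continuous_prod_of_continuous_lipschitzWith' (fun q : ℝ × X => S |q.1| q.2) 1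
    (fun t => hS.lipschitzWith |t| (abs_nonneg t))
    fun x => (hS.continuousOn x).comp_continuous continuous_abs abs_nonneg

theorem IsContractionFamily.exists_norm_abs_le (hS : IsContractionFamily S) (R : ℝ) :
    ∃ C, ∀ t, |t| ≤ R → ∀ x, ‖S |t| x‖ ≤ ‖x‖ + C := by
  obtain ⟨C, hC⟩ := (isCompact_Icc (a := 0) (b := R)).exists_bound_of_continuousOn
    ((hS.continuousOn 0).mono Icc_subset_Ici_self)
  refine ⟨C, fun t ht x => ?_⟩
  have hlip : ‖S |t| x - S |t| 0‖ ≤ ‖x‖ := by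
    simpa [dist_eq_norm] using (hS.lipschitzWith |t| (abs_nonneg t)).dist_le_mul x 0
  calc ‖S |t| x‖ ≤ ‖S |t| x - S |t| 0‖ + ‖S |t| 0‖ := norm_le_norm_sub_add _ _
    _ ≤ ‖x‖ + C := add_le_add hlip (hC _ ⟨abs_nonneg t, ht⟩)

theorem IsContractionFamily.aestronglyMeasurable_abs_sub (hS : IsContractionFamily S) {f : ℝ → X}
    {μ : Measure ℝ} (hf : AEStronglyMeasurable f μ) (t : ℝ) :
    AEStronglyMeasurable (fun s => S |t - s| (f s)) μ :=
  hS.continuous_uncurry_abs.comp_aestronglyMeasurable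
    ((by fun_prop : Continuous fun s => t - s).aestronglyMeasurable.prodMk hf)

theorem IsContractionFamily.intervalIntegrable (hS : IsContractionFamily S) {f : ℝ → X} {t : ℝ}
    (ht : 0 ≤ t) (hf : IntervalIntegrable f volume 0 t) :
    IntervalIntegrable (fun s => S (t - s) (f s)) volume 0 t := by
  obtain ⟨C, hC⟩ := hS.exists_norm_abs_le t
  have habs : IntervalIntegrable (fun s => S |t - s| (f s)) volume 0 t := by
    refine (hf.norm.add (intervalIntegrable_const (c := C))).mono_fun'
      (hS.aestronglyMeasurable_abs_sub hf.aestronglyMeasurable_restrict_uIoc t) ?_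
    filter_upwards [ae_restrict_mem measurableSet_uIoc] with s hs
    rw [uIoc_of_le ht] at hs
    exact hC _ (abs_le.2 ⟨by linarith [hs.2], by linarith [hs.1]⟩) (f s)
  refine habs.congr fun s hs => ?_
  rw [uIoc_of_le ht] at hs
  simp only [abs_of_nonneg (sub_nonneg.2 hs.2)]

variable [NormedSpace ℝ X]

theorem IsContractionFamily.continuous_integral_abs (hS : IsContractionFamily S) {f : ℝ → X}
    (hf : Integrable f) : Continuous fun t => ∫ s in (0 : ℝ)..t, S |t - s| (f s) := by
  rw [continuous_iff_continuousAt]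
  intro t
  set R : ℝ := |t| + 1
  have ht : |t| < R := lt_add_one _
  obtain ⟨C, hC⟩ := hS.exists_norm_abs_le (2 * R)
  refine ContinuousAt.comp (f := fun t : ℝ => (t, t)) (x := t)
    (g := fun q : ℝ × ℝ => ∫ s in (0 : ℝ)..q.2, S |q.1 - s| (f s)) ?_ (by fun_prop)
  refine intervalIntegral.continuousAt_parametric_primitive_of_dominated
    (fun s => ‖f s‖ + C) (-R) R (fun r => hS.aestronglyMeasurable_abs_sub hf.1.restrict r) ?_
    (hf.norm.intervalIntegrable.add intervalIntegrable_const) ?_ ?_ (abs_lt.1 ht)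
    (measure_singleton t)
  · filter_upwards [continuous_abs.continuousAt.eventually_lt_const ht] with r hr
    filter_upwards [ae_restrict_mem measurableSet_uIoc] with s hs
    rw [uIoc_of_le (by linarith [abs_nonneg t])] at hs
    refine hC _ ((abs_sub r s).trans ?_) (f s)
    linarith [abs_le.2 ⟨hs.1.le, hs.2⟩]
  · exact Eventually.of_forall fun s => (hS.continuous_uncurry_abs.comp
      (by fun_prop : Continuous fun r : ℝ => (r - s, f s))).continuousAt
  · have hR : 0 < R := (abs_nonneg t).trans_lt ht
    exact ⟨neg_lt_zero.2 hR, hR⟩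

theorem IsContractionFamily.continuousOn_integral (hS : IsContractionFamily S) {T : ℝ} {f : ℝ → X}
    (hf : IntegrableOn f (Ioo 0 T)) :
    ContinuousOn (fun t => ∫ s in (0 : ℝ)..t, S (t - s) (f s)) (Icc 0 T) := by
  refine (hS.continuous_integral_abs
    (hf.integrable_indicator measurableSet_Ioo)).continuousOn.congr fun t ht => ?_
  simp only [intervalIntegral.integral_of_le ht.1, integral_Ioc_eq_integral_Ioo]
  refine setIntegral_congr_fun measurableSet_Ioo fun s hs => ?_
  simp only [indicator_of_mem (Ioo_subset_Ioo_right ht.2 hs), abs_of_pos (sub_pos.2 hs.2)]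

theorem IsContractionFamily.norm_integral_sub_integral_le (hS : IsContractionFamily S)
    {f g : ℝ → X} {b : ℝ → ℝ} {t : ℝ} (ht : 0 ≤ t) (hf : IntervalIntegrable f volume 0 t)
    (hg : IntervalIntegrable g volume 0 t) (hb : IntervalIntegrable b volume 0 t)
    (hfg : ∀ᵐ s, s ∈ Ioc 0 t → ‖f s - g s‖ ≤ b s) :
    ‖(∫ s in (0 : ℝ)..t, S (t - s) (f s)) - ∫ s in (0 : ℝ)..t, S (t - s) (g s)‖ ≤
      ∫ s in (0 : ℝ)..t, b s := by
  rw [← intervalIntegral.integral_sub (hS.intervalIntegrable ht hf) (hS.intervalIntegrable ht hg)]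
  refine intervalIntegral.norm_integral_le_of_norm_le ht ?_ hb
  filter_upwards [hfg] with s hs hst
  refine le_trans ?_ (hs hst)
  simpa [dist_eq_norm] using
    (hS.lipschitzWith (t - s) (sub_nonneg.2 hst.2)).dist_le_mul (f s) (g s)

end ContractionFamily

section Superposition

theorem aestronglyMeasurable_superposition {α X Y : Type*} [MeasurableSpace α] {μ : Measure α}
    [TopologicalSpace X] [TopologicalSpace Y] [TopologicalSpace.PseudoMetrizableSpace Y]
    {F : α → X → Y} (hF : ∀ x, AEStronglyMeasurable (fun s => F s x) μ)
    (hcont : ∀ᵐ s ∂μ, Continuous (F s)) {U : α → X} (hU : StronglyMeasurable U) :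
    AEStronglyMeasurable (fun s => F s (U s)) μ := by
  have hsimple (g : SimpleFunc α X) : AEStronglyMeasurable (fun s => F s (g s)) μ := by
    have hcover : ⋃ x : g.range, g ⁻¹' {(x : X)} = univ :=
      eq_univ_of_forall fun s => mem_iUnion.2 ⟨⟨g s, g.mem_range_self s⟩, rfl⟩
    rw [← Measure.restrict_univ (μ := μ), ← hcover, aestronglyMeasurable_iUnion_iff]
    exact fun x => (hF x).restrict.congr <|
      (ae_restrict_iff' (g.measurableSet_fiber x)).2 (Eventually.of_forall fun s hs =>
        congrArg (F s) (mem_preimage.1 hs).symm)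
  refine aestronglyMeasurable_of_tendsto_ae atTop (fun n => hsimple (hU.approx n)) ?_
  filter_upwards [hcont] with s hs
  exact (hs.tendsto _).comp (hU.tendsto_approx s)

theorem integrable_superposition {α X Y : Type*} [MeasurableSpace α] {μ : Measure α}
    [NormedAddCommGroup X] [NormedAddCommGroup Y] {F : α → X → Y} {φ : α → ℝ}
    (hF : ∀ x, AEStronglyMeasurable (fun s => F s x) μ) (hF₀ : Integrable (fun s => F s 0) μ)
    (hφ : Integrable φ μ) (hLip : ∀ᵐ s ∂μ, LipschitzWith ‖φ s‖₊ (F s)) {U : α → X} {C : ℝ}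
    (hU : StronglyMeasurable U) (hUC : ∀ s, ‖U s‖ ≤ C) : Integrable (fun s => F s (U s)) μ := by
  refine (hF₀.norm.add (hφ.norm.mul_const C)).mono' (aestronglyMeasurable_superposition hF
    (hLip.mono fun s hs => hs.continuous) hU) ?_
  filter_upwards [hLip] with s hs
  have hdist : ‖F s (U s) - F s 0‖ ≤ ‖φ s‖ * ‖U s‖ := by
    simpa [dist_eq_norm] using hs.dist_le_mul (U s) 0
  calc ‖F s (U s)‖ ≤ ‖F s 0‖ + ‖F s (U s) - F s 0‖ := norm_le_norm_add_norm_sub' _ _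
    _ ≤ ‖F s 0‖ + ‖φ s‖ * C := by gcongr; exact hdist.trans (by gcongr; exact hUC s)

theorem StructuralCondition.ae_lipschitzWith {X : Type*} [NormedAddCommGroup X] {T : ℝ}
    {K : ℝ → ℝ → ℝ} {F : ℝ → X → X} {φ : ℝ → ℝ} (hFK : StructuralCondition T K F)
    (hKφ : ∀ᵐ t ∂(volume.restrict (Ioo 0 T)), ∀ U : ℝ, 0 ≤ U → K t U ≤ φ t * U) :
    ∀ᵐ t ∂(volume.restrict (Ioo 0 T)), LipschitzWith ‖φ t‖₊ (F t) := by
  filter_upwards [hFK.bound, hKφ] with t hbound hlinear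
  refine LipschitzWith.of_dist_le_mul fun u v => ?_
  calc dist (F t u) (F t v) = ‖F t u - F t v‖ := dist_eq_norm _ _
    _ ≤ K t ‖u - v‖ := hbound u v
    _ ≤ φ t * ‖u - v‖ := hlinear _ (norm_nonneg _)
    _ ≤ ‖φ t‖ * ‖u - v‖ := by gcongr; exact Real.le_norm_self _
    _ = ‖φ t‖₊ * dist u v := by rw [coe_nnnorm, dist_eq_norm]

end Superposition

section Hoelder

theorem integral_norm_mul_norm_le {α E F : Type*} [MeasurableSpace α] {μ : Measure α}
    [NormedAddCommGroup E] [NormedAddCommGroup F] {p q : ℝ≥0∞} [p.HolderConjugate q]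
    {f : α → E} {g : α → F} (hf : MemLp f p μ) (hg : MemLp g q μ) :
    ∫ a, ‖f a‖ * ‖g a‖ ∂μ ≤ (eLpNorm f p μ).toReal * (eLpNorm g q μ).toReal := by
  have hsmul := eLpNorm_smul_le_mul_eLpNorm (p := p) (q := q) (r := 1) hg.norm.1 hf.norm.1
  rw [eLpNorm_norm, eLpNorm_norm] at hsmul
  calc ∫ a, ‖f a‖ * ‖g a‖ ∂μ
      = (eLpNorm ((fun a => ‖f a‖) • fun a => ‖g a‖) 1 μ).toReal := by
        rw [eLpNorm_one_eq_lintegral_enorm,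
          ← integral_norm_eq_lintegral_enorm (hf.norm.1.smul hg.norm.1)]
        simp
    _ ≤ (eLpNorm f p μ * eLpNorm g q μ).toReal :=
        ENNReal.toReal_mono (ENNReal.mul_ne_top hf.2.ne hg.2.ne) hsmul
    _ = (eLpNorm f p μ).toReal * (eLpNorm g q μ).toReal := ENNReal.toReal_mul

theorem eLpNorm_exp_mul_Iic {γ : ℝ} (hγ : 0 < γ) {q : ℝ≥0∞} (hq₀ : q ≠ 0) (hq : q ≠ ∞) (t : ℝ) :
    eLpNorm (fun s => Real.exp (γ * s)) q (volume.restrict (Iic t)) =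
      ENNReal.ofReal (Real.exp (γ * t) * (γ * q.toReal) ^ (-q.toReal⁻¹)) := by
  have hq_pos : 0 < q.toReal := ENNReal.toReal_pos hq₀ hq
  have hγq : 0 < γ * q.toReal := mul_pos hγ hq_pos
  have hpow (s : ℝ) : ‖Real.exp (γ * s)‖ₑ ^ q.toReal =
      ENNReal.ofReal (Real.exp (γ * q.toReal * s)) := by
    rw [Real.enorm_eq_ofReal (Real.exp_pos _).le, ENNReal.ofReal_rpow_of_nonneg
      (Real.exp_pos _).le hq_pos.le, ← Real.exp_mul, mul_right_comm]
  have hexp : Real.exp (γ * q.toReal * t) ^ q.toReal⁻¹ = Real.exp (γ * t) := by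
    rw [← Real.exp_mul]; field_simp
  simp only [eLpNorm_eq_lintegral_rpow_enorm_toReal hq₀ hq, hpow, one_div]
  rw [← ofReal_integral_eq_lintegral_ofReal (integrableOn_exp_mul_Iic hγq t)
      (Eventually.of_forall fun s => (Real.exp_pos _).le), integral_exp_mul_Iic hγq,
    ENNReal.ofReal_rpow_of_nonneg (by positivity) (by positivity),
    Real.div_rpow (Real.exp_pos _).le hγq.le, hexp, Real.rpow_neg hγq.le, div_eq_mul_inv]

theorem integral_abs_mul_exp_le {p q : ℝ≥0∞} [p.HolderConjugate q] (hq : q ≠ ∞) {T : ℝ}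
    {φ : ℝ → ℝ} (hφ : MemLp φ p (volume.restrict (Ioo 0 T))) {γ : ℝ} (hγ : 0 < γ) {t : ℝ}
    (ht : t ∈ Icc 0 T) :
    ∫ s in (0 : ℝ)..t, |φ s| * Real.exp (γ * s) ≤
      lpNormOn T p φ * (Real.exp (γ * t) * (γ * q.toReal) ^ (-q.toReal⁻¹)) := by
  have hφ_le : volume.restrict (Ioo 0 t) ≤ volume.restrict (Ioo 0 T) :=
    Measure.restrict_mono (Ioo_subset_Ioo_right ht.2) le_rfl
  have hexp_le : eLpNorm (fun s => Real.exp (γ * s)) q (volume.restrict (Ioo 0 t)) ≤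
      ENNReal.ofReal (Real.exp (γ * t) * (γ * q.toReal) ^ (-q.toReal⁻¹)) := by
    rw [← eLpNorm_exp_mul_Iic hγ (ENNReal.HolderConjugate.ne_zero q p) hq t]
    exact eLpNorm_mono_measure _ (Measure.restrict_mono (fun s hs => hs.2.le) le_rfl)
  have hexp : MemLp (fun s => Real.exp (γ * s)) q (volume.restrict (Ioo 0 t)) :=
    ⟨(by fun_prop : Continuous fun s => Real.exp (γ * s)).aestronglyMeasurable,
      hexp_le.trans_lt ENNReal.ofReal_lt_top⟩
  calc ∫ s in (0 : ℝ)..t, |φ s| * Real.exp (γ * s)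
      = ∫ s in Ioo 0 t, ‖φ s‖ * ‖Real.exp (γ * s)‖ := by
        simp [intervalIntegral.integral_of_le ht.1, integral_Ioc_eq_integral_Ioo]
    _ ≤ (eLpNorm φ p (volume.restrict (Ioo 0 t))).toReal *
          (eLpNorm (fun s => Real.exp (γ * s)) q (volume.restrict (Ioo 0 t))).toReal :=
        integral_norm_mul_norm_le (hφ.mono_measure hφ_le) hexp
    _ ≤ lpNormOn T p φ * (Real.exp (γ * t) * (γ * q.toReal) ^ (-q.toReal⁻¹)) := by
        gcongr
        · exact ENNReal.toReal_nonneg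
        · exact ENNReal.toReal_mono hφ.2.ne (eLpNorm_mono_measure _ hφ_le)
        · exact ENNReal.toReal_le_of_le_ofReal (by positivity) hexp_le

end Hoelder

theorem intervalIntegrable_of_integrableOn_Ioo {E : Type*} [NormedAddCommGroup E] {f : ℝ → E}
    {a b t : ℝ} (hf : IntegrableOn f (Ioo a b)) (ht : t ∈ Icc a b) :
    IntervalIntegrable f volume a t :=
  (intervalIntegrable_iff_integrableOn_Ioo_of_le ht.1).2
    (hf.mono_set (Ioo_subset_Ioo_right ht.2))

theorem exp_neg_mul_mul_le_iff {c r a b : ℝ} :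
    Real.exp (-c * r) * a ≤ b ↔ a ≤ Real.exp (c * r) * b := by
  rw [neg_mul, Real.exp_neg, inv_mul_le_iff₀ (Real.exp_pos _)]

theorem mul_rpow_neg_inv_lt_one {a x q : ℝ} (ha : 0 ≤ a) (hq : 0 < q) (h : a ^ q < x) :
    a * x ^ (-q⁻¹) < 1 := by
  have hx : 0 < x := (Real.rpow_nonneg ha q).trans_lt h
  rw [Real.rpow_neg hx.le, ← div_eq_mul_inv, div_lt_one (by positivity)]
  exact (Real.lt_rpow_inv_iff_of_pos ha hx.le hq).2 h

section Bielecki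

variable {X : Type*} [NormedAddCommGroup X] {T : ℝ}

theorem bieleckiNorm_nonneg (γ : ℝ) (u : C(Icc (0 : ℝ) T, X)) : 0 ≤ bieleckiNorm γ u :=
  Real.iSup_nonneg fun _ => by positivity

theorem exp_mul_norm_le_bieleckiNorm (γ : ℝ) (u : C(Icc (0 : ℝ) T, X)) (t : Icc (0 : ℝ) T) :
    Real.exp (-γ * t) * ‖u t‖ ≤ bieleckiNorm γ u :=
  le_ciSup (isCompact_range (by fun_prop :
    Continuous fun t : Icc (0 : ℝ) T => Real.exp (-γ * t) * ‖u t‖)).bddAbove t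

theorem norm_apply_le_exp_mul_bieleckiNorm (γ : ℝ) (u : C(Icc (0 : ℝ) T, X))
    (t : Icc (0 : ℝ) T) : ‖u t‖ ≤ Real.exp (γ * t) * bieleckiNorm γ u :=
  exp_neg_mul_mul_le_iff.1 (exp_mul_norm_le_bieleckiNorm γ u t)

theorem bieleckiNorm_le {γ M : ℝ} (hM : 0 ≤ M) {u : C(Icc (0 : ℝ) T, X)}
    (hu : ∀ t, ‖u t‖ ≤ Real.exp (γ * t) * M) : bieleckiNorm γ u ≤ M :=
  Real.iSup_le (fun t => exp_neg_mul_mul_le_iff.2 (hu t)) hM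

theorem isBieleckiContraction_of_norm_sub_le_integral (hT : 0 ≤ T) {p q : ℝ≥0∞}
    [p.HolderConjugate q] (hq : q ≠ ∞) {φ : ℝ → ℝ} (hφ : MemLp φ p (volume.restrict (Ioo 0 T)))
    {G : C(Icc (0 : ℝ) T, X) → C(Icc (0 : ℝ) T, X)}
    (hG : ∀ u v (t : Icc (0 : ℝ) T),
      ‖G u t - G v t‖ ≤ ∫ s in (0 : ℝ)..t, |φ s| * ‖IccExtend hT (u - v) s‖)
    {γ : ℝ} (hγ : lpNormOn T p φ ^ q.toReal / q.toReal < γ) : IsBieleckiContraction γ G := by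
  have hq_pos : 0 < q.toReal := ENNReal.toReal_pos (ENNReal.HolderConjugate.ne_zero q p) hq
  have hN : 0 ≤ lpNormOn T p φ := ENNReal.toReal_nonneg
  have hγ_pos : 0 < γ := lt_of_le_of_lt (by positivity) hγ
  refine ⟨lpNormOn T p φ * (γ * q.toReal) ^ (-q.toReal⁻¹), by positivity,
    mul_rpow_neg_inv_lt_one hN hq_pos ((div_lt_iff₀ hq_pos).1 hγ), fun u v => ?_⟩
  set B := bieleckiNorm γ (u - v)
  have hB : 0 ≤ B := bieleckiNorm_nonneg _ _
  refine bieleckiNorm_le (by positivity) fun t => ?_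
  have hφ_int : IntervalIntegrable (fun s => |φ s|) volume 0 t :=
    (intervalIntegrable_of_integrableOn_Ioo
      (hφ.integrable (ENNReal.HolderConjugate.one_le p q)) t.2).abs
  calc ‖G u t - G v t‖
      ≤ ∫ s in (0 : ℝ)..t, |φ s| * ‖IccExtend hT (u - v) s‖ := hG u v t
    _ ≤ ∫ s in (0 : ℝ)..t, |φ s| * Real.exp (γ * s) * B := by
        refine intervalIntegral.integral_mono_on t.2.1
          (hφ_int.mul_continuousOn ((u - v).continuous.Icc_extend').norm.continuousOn)
          ((hφ_int.mul_continuousOn (by fun_prop)).mul_const B) fun s hs => ?_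
        have hsT : s ∈ Icc 0 T := ⟨hs.1, hs.2.trans t.2.2⟩
        rw [mul_assoc, IccExtend_of_mem hT _ hsT]
        gcongr
        exact norm_apply_le_exp_mul_bieleckiNorm γ (u - v) ⟨s, hsT⟩
    _ ≤ lpNormOn T p φ * (Real.exp (γ * t) * (γ * q.toReal) ^ (-q.toReal⁻¹)) * B := by
        rw [intervalIntegral.integral_mul_const]
        gcongr
        exact integral_abs_mul_exp_le hq hφ hγ_pos t.2
    _ = Real.exp (γ * t) * (lpNormOn T p φ * (γ * q.toReal) ^ (-q.toReal⁻¹) * B) := by ring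

/-- The weight `t ↦ e^{c t}` on `[0, T]`. Multiplication by it is an isometry between the Bielecki
norms of different weights. -/
noncomputable def expWeight (T c : ℝ) : C(Icc (0 : ℝ) T, ℝ) where
  toFun t := Real.exp (c * t)

variable [NormedSpace ℝ X]

theorem norm_expWeight_neg_smul (γ : ℝ) (u : C(Icc (0 : ℝ) T, X)) :
    ‖expWeight T (-γ) • u‖ = bieleckiNorm γ u := by
  simp [ContinuousMap.norm_eq_iSup_norm, bieleckiNorm, expWeight, norm_smul]

theorem expWeight_neg_smul_expWeight_smul (c : ℝ) (u : C(Icc (0 : ℝ) T, X)) :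
    expWeight T (-c) • expWeight T c • u = u := by
  ext t
  simp [expWeight, smul_smul, ← Real.exp_add]

theorem IsBieleckiContraction.existsUnique_fixedPoint [CompleteSpace X] {γ : ℝ}
    {G : C(Icc (0 : ℝ) T, X) → C(Icc (0 : ℝ) T, X)} (hG : IsBieleckiContraction γ G) :
    ∃! u : C(Icc (0 : ℝ) T, X), G u = u := by
  obtain ⟨k, hk_nonneg, hk_lt, hk⟩ := hG
  have hdist (u v : C(Icc (0 : ℝ) T, X)) :
      dist (expWeight T (-γ) • u) (expWeight T (-γ) • v) = bieleckiNorm γ (u - v) := by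
    rw [dist_eq_norm, ← smul_sub, norm_expWeight_neg_smul]
  have hinv (u : C(Icc (0 : ℝ) T, X)) : expWeight T γ • expWeight T (-γ) • u = u := by
    simpa using expWeight_neg_smul_expWeight_smul (-γ) u
  have hcontr : ContractingWith ⟨k, hk_nonneg⟩
      fun v => expWeight T (-γ) • G (expWeight T γ • v) := by
    refine ⟨hk_lt, LipschitzWith.of_dist_le_mul fun v w => ?_⟩
    calc dist (expWeight T (-γ) • G (expWeight T γ • v)) (expWeight T (-γ) • G (expWeight T γ • w))
        = bieleckiNorm γ (G (expWeight T γ • v) - G (expWeight T γ • w)) := hdist _ _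
      _ ≤ k * bieleckiNorm γ (expWeight T γ • v - expWeight T γ • w) := hk _ _
      _ = k * dist v w := by
          rw [← hdist, expWeight_neg_smul_expWeight_smul, expWeight_neg_smul_expWeight_smul]
  refine ⟨expWeight T γ • hcontr.fixedPoint _, ?_, fun u hu => ?_⟩
  · simpa only [hinv] using congrArg (expWeight T γ • ·) hcontr.fixedPoint_isFixedPt
  · have hfixed : expWeight T (-γ) • G (expWeight T γ • expWeight T (-γ) • u) =
        expWeight T (-γ) • u := by rw [hinv, hu]
    rw [← hcontr.fixedPoint_unique hfixed, hinv]

end Bielecki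

section Duhamel

variable {X : Type*} [NormedAddCommGroup X] [NormedSpace ℝ X] {A : Set (X × X)} {T : ℝ}
  {F : ℝ → X → X}

theorem exists_duhamelOperator (hS : IsContractionFamily (semigroup A)) (hT : 0 ≤ T)
    (hF : ∀ u : C(Icc (0 : ℝ) T, X), IntegrableOn (fun s => F s (IccExtend hT u s)) (Ioo 0 T))
    (u₀ : X) :
    ∃ G : C(Icc (0 : ℝ) T, X) → C(Icc (0 : ℝ) T, X), ∀ u (t : Icc (0 : ℝ) T),
      IntervalIntegrable (duhamelIntegrand A F hT u t) volume 0 t ∧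
        G u t = duhamelMap A F hT u₀ u t := by
  have hcont (u : C(Icc (0 : ℝ) T, X)) : ContinuousOn (duhamelMap A F hT u₀ u) (Icc 0 T) :=
    ((hS.continuousOn u₀).mono Icc_subset_Ici_self).add (hS.continuousOn_integral (hF u))
  exact ⟨fun u => ⟨_, (hcont u).domRestrict⟩, fun u t =>
    ⟨hS.intervalIntegrable t.2.1 (intervalIntegrable_of_integrableOn_Ioo (hF u) t.2), rfl⟩⟩

theorem norm_duhamelMap_sub_duhamelMap_le (hS : IsContractionFamily (semigroup A)) (hT : 0 ≤ T)
    {φ : ℝ → ℝ} (hφ : IntegrableOn φ (Ioo 0 T))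
    (hLip : ∀ᵐ t ∂(volume.restrict (Ioo 0 T)), LipschitzWith ‖φ t‖₊ (F t))
    {u v : C(Icc (0 : ℝ) T, X)} (hu : IntegrableOn (fun s => F s (IccExtend hT u s)) (Ioo 0 T))
    (hv : IntegrableOn (fun s => F s (IccExtend hT v s)) (Ioo 0 T)) (u₀ : X) {t : ℝ}
    (ht : t ∈ Icc 0 T) :
    ‖duhamelMap A F hT u₀ u t - duhamelMap A F hT u₀ v t‖ ≤
      ∫ s in (0 : ℝ)..t, |φ s| * ‖IccExtend hT (u - v) s‖ := by
  rw [duhamelMap, duhamelMap, add_sub_add_left_eq_sub]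
  refine hS.norm_integral_sub_integral_le ht.1 (intervalIntegrable_of_integrableOn_Ioo hu ht)
    (intervalIntegrable_of_integrableOn_Ioo hv ht)
    ((intervalIntegrable_of_integrableOn_Ioo hφ ht).abs.mul_continuousOn
      ((u - v).continuous.Icc_extend').norm.continuousOn) ?_
  rw [← ae_restrict_iff' measurableSet_Ioc, ← restrict_Ioo_eq_restrict_Ioc]
  filter_upwards [ae_restrict_of_ae_restrict_of_subset (Ioo_subset_Ioo_right ht.2) hLip] with s hs
  simpa [dist_eq_norm, IccExtend] using hs.dist_le_mul (IccExtend hT u s) (IccExtend hT v s)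

end Duhamel

theorem conjExponent_ne_top {p : ℝ≥0∞} (hp : 1 < p) : p.conjExponent ≠ ∞ := by
  simp [ENNReal.conjExponent, tsub_eq_zero_iff_le, hp]

theorem toReal_conjExponent {p : ℝ≥0∞} (hp : 1 < p) (hp_top : p ≠ ∞) :
    p.conjExponent.toReal = p.toReal / (p.toReal - 1) :=
  have := ENNReal.HolderConjugate.conjExponent hp.le
  (ENNReal.HolderConjugate.toReal_of_ne_top hp_top (conjExponent_ne_top hp)).conjugate_eq

end NonlinearCauchy

theorem corollary3p1 {X : Type*} [NormedAddCommGroup X] [NormedSpace ℝ X] [CompleteSpace X]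
    (A : Set (X × X)) (hA : NonlinearCauchy.IsMAccretive A)
    (hdense : Dense (NonlinearCauchy.domain A))
    (T : ℝ) (hT : 0 < T) (F : ℝ → X → X) (K : ℝ → ℝ → ℝ)
    (hFint : ∀ x : X, IntegrableOn (fun s => F s x) (Ioo 0 T) volume)
    (hFK : NonlinearCauchy.StructuralCondition T K F)
    (p : ℝ≥0∞) (hp : 1 < p) (φ : ℝ → ℝ) (hφ : MemLp φ p (volume.restrict (Ioo 0 T)))
    (hKφ : ∀ᵐ t ∂(volume.restrict (Ioo 0 T)), ∀ U : ℝ, 0 ≤ U → K t U ≤ φ t * U)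
    (u₀ : X) :
    ∃ G : C(Icc (0 : ℝ) T, X) → C(Icc (0 : ℝ) T, X),
      (∀ (u : C(Icc (0 : ℝ) T, X)) (t : Icc (0 : ℝ) T),
        IntervalIntegrable (NonlinearCauchy.duhamelIntegrand A F hT.le u t) volume 0 t ∧
        G u t = NonlinearCauchy.duhamelMap A F hT.le u₀ u t) ∧
      (p ≠ ∞ → ∀ γ : ℝ,
        (p.toReal - 1) / p.toReal *
            NonlinearCauchy.lpNormOn T p φ ^ (p.toReal / (p.toReal - 1)) < γ →
        NonlinearCauchy.IsBieleckiContraction γ G) ∧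
      (p = ∞ → ∀ γ : ℝ, NonlinearCauchy.lpNormOn T ∞ φ < γ →
        NonlinearCauchy.IsBieleckiContraction γ G) ∧
      ∃! u : C(Icc (0 : ℝ) T, X), G u = u := by
  have hLip := hFK.ae_lipschitzWith hKφ
  have hφ_int : IntegrableOn φ (Ioo 0 T) := hφ.integrable hp.le
  have hS := hA.isContractionFamily_semigroup hdense
  have hF_int (u : C(Icc (0 : ℝ) T, X)) :
      IntegrableOn (fun s => F s (IccExtend hT.le u s)) (Ioo 0 T) :=
    NonlinearCauchy.integrable_superposition (fun x => (hFint x).1) (hFint 0) hφ_int hLip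
      u.continuous.Icc_extend'.stronglyMeasurable fun s => u.norm_coe_le_norm _
  obtain ⟨G, hG⟩ := NonlinearCauchy.exists_duhamelOperator hS hT.le hF_int u₀
  have hVolterra (u v : C(Icc (0 : ℝ) T, X)) (t : Icc (0 : ℝ) T) :
      ‖G u t - G v t‖ ≤ ∫ s in (0 : ℝ)..t, |φ s| * ‖IccExtend hT.le (u - v) s‖ := by
    rw [(hG u t).2, (hG v t).2]
    exact NonlinearCauchy.norm_duhamelMap_sub_duhamelMap_le hS hT.le hφ_int hLip (hF_int u)
      (hF_int v) u₀ t.2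
  have := ENNReal.HolderConjugate.conjExponent hp.le
  have hq := NonlinearCauchy.conjExponent_ne_top hp
  have hcontr (γ : ℝ) (hγ : _ < γ) : NonlinearCauchy.IsBieleckiContraction γ G :=
    NonlinearCauchy.isBieleckiContraction_of_norm_sub_le_integral hT.le hq hφ hVolterra hγ
  refine ⟨G, hG, fun hp_top γ hγ => hcontr γ ?_, fun hp_top γ hγ => hcontr γ ?_,
    (hcontr _ (lt_add_one _)).existsUnique_fixedPoint⟩
  · rwa [NonlinearCauchy.toReal_conjExponent hp hp_top, div_eq_inv_mul, inv_div]
  · subst hp_top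
    simpa [ENNReal.conjExponent] using hγ
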